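/- Let $G$ be a plane triangulation, that is, a finite simple connected plane graph all of whose faces have length $3$. Let $G^*$ be its dual (a multigraph whose vertices are the faces of $G$ and in which every edge $e$ of $G$ yields an edge $e^*$ joining the faces on the two sides of $e$). Suppose that $G^*$ has a $2$-factor $C^*$ (a $2$-regular spanning subgraph) that contains at most two cycles, and let $S=\{e\in E(G): e^*\notin E(C^*)\}$. Then $S^*=E(G^*)\setminus E(C^*)$ is a perfect matching of $G^*$; $S$ is a $1$-selection set of $G$, i.e. $S=\{f(v): v\in V(G)\}\setminus\{\emptyset\}$ for some map $f:V(G)\to E(G)\cup\{\emptyset\}$ such that, for every vertex $v$, $f(v)$ is an edge incident with $v$ or $f(v)=\emptyset$; and $G-S$, with the embedding inherited from $G$, is a quadrangulation (a connected plane graph all of whose faces have length $4$), and it is bipartite. If moreover $|V(G)|\ge 4$, then $\chi_1(G)=2$, where $\chi_1(G)$, the robust chromatic number, is the minimum of $\chi(G-S')$ over all $1$-selection sets $S'$ of $G$. (Here the length of a face is the length of its boundary walk, a bridge being counted twice.) -/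

import Mathlib

/-! ### Robust colouring -/

namespace SimpleGraph

variable {V : Type*}

/-- `f` is a 1-selection of `G`: it assigns to every vertex at most one edge incident with it
(`none` stands for the empty value). -/
def IsOneSelection (G : SimpleGraph V) (f : V → Option (Sym2 V)) : Prop :=
  ∀ v e, f v = some e → e ∈ G.incidenceSet v

/-- The set of edges picked by `f`. -/
def selectedEdges (f : V → Option (Sym2 V)) : Set (Sym2 V) :=
  {e | ∃ v, f v = some e}

/-- `S` is a 1-selection set of `G`: the set of edges picked by some 1-selection. -/
def IsOneSelectionSet (G : SimpleGraph V) (S : Set (Sym2 V)) : Prop :=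
  ∃ f : V → Option (Sym2 V), G.IsOneSelection f ∧ selectedEdges f = S

/-- The robust chromatic number: the minimum, over all 1-selections `f` of `G`, of the chromatic
number of the graph obtained from `G` by deleting the edges picked by `f`.
(A minimum: `ℕ∞` is well-ordered, and the constant `none` is a 1-selection.) -/
noncomputable def robustChromaticNumber (G : SimpleGraph V) : ℕ∞ :=
  ⨅ f : {f : V → Option (Sym2 V) // G.IsOneSelection f},
    (G.deleteEdges (selectedEdges f.1)).chromaticNumber

end SimpleGraph

/-! ### Factors and cycles of multigraphs -/

namespace Graph

variable {α β : Type*}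

/-- The degree of `x` in a multigraph; loops count twice. -/
noncomputable def factorDegree (G : Graph α β) (x : α) : ℕ∞ :=
  (G.incidenceSet x).encard + (G.loopSet x).encard

/-- Every vertex has degree `k`. -/
def IsRegularMultigraph (G : Graph α β) (k : ℕ) : Prop :=
  ∀ x ∈ G.vertexSet, G.factorDegree x = k

/-- `H` is a `k`-factor of `G`: a `k`-regular spanning subgraph. -/
def IsFactor (H G : Graph α β) (k : ℕ) : Prop :=
  H.IsSpanningSubgraph G ∧ H.IsRegularMultigraph k

/-- A cycle, as a multigraph: finite, nonempty, connected and 2-regular. (A loop and a pair of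
parallel edges are cycles of length 1 and 2.) -/
structure IsCycleGraph (C : Graph α β) : Prop where
  finite : C.vertexSet.Finite
  nonempty : C.vertexSet.Nonempty
  connected : ∀ x ∈ C.vertexSet, ∀ y ∈ C.vertexSet, Relation.ReflTransGen C.Adj x y
  regular : C.IsRegularMultigraph 2

/-- The set of cycles contained in `G`. -/
def cycleSubgraphs (G : Graph α β) : Set (Graph α β) :=
  {C | C ≤ G ∧ C.IsCycleGraph}

end Graph

/-! ### Plane graphs

An embedding of a finite connected graph in an oriented closed surface, up to
orientation-preserving homeomorphism, is encoded by its rotation system: the cyclic (say,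
counterclockwise) order of the darts that leave each vertex. The surface is the sphere exactly
when Euler's formula holds, and embeddings in the sphere and in the plane are the same up to the
choice of the outer face, which plays no role here. -/

namespace SimpleGraph

variable {V : Type*}

/-- A rotation system on `G`: a permutation `next` of the darts whose orbits are exactly the sets
of darts leaving a common vertex. -/
structure RotationSystem (G : SimpleGraph V) where
  /-- The dart following a given dart in the cyclic order around its initial vertex. -/
  next : Equiv.Perm G.Dart
  next_fst : ∀ d, (next d).fst = d.fst
  sameCycle_of_fst_eq : ∀ d d' : G.Dart, d.fst = d'.fst → next.SameCycle d d'

namespace RotationSystem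

variable {G : SimpleGraph V}

/-- One step of face tracing: traverse the dart, then leave its end along the next dart after the
reversed one. -/
def faceStep (R : G.RotationSystem) : Equiv.Perm G.Dart :=
  (Dart.symm_involutive (G := G)).toPerm.trans R.next

/-- The faces: the orbits of face tracing, i.e. the facial closed walks. -/
def Face (R : G.RotationSystem) : Type _ :=
  Quotient (Equiv.Perm.SameCycle.setoid R.faceStep)

/-- The face on the chosen side of a dart (the face on the other side is that of `d.symm`). -/
def face (R : G.RotationSystem) (d : G.Dart) : R.Face :=
  Quotient.mk (Equiv.Perm.SameCycle.setoid R.faceStep) d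

/-- The length of a face: the length of its facial walk; an edge with the face on both sides
(a bridge) counts twice. -/
noncomputable def faceLength (R : G.RotationSystem) (φ : R.Face) : ℕ :=
  Nat.card {d : G.Dart // R.face d = φ}

/-- `G` with this rotation system is a (finite) connected plane graph with at least one edge:
Euler's formula `|V| - |E| + |F| = 2` holds. (The one-vertex graph has no darts and
thus no facial walks here, and it is not `IsPlane`.) -/
def IsPlane (R : G.RotationSystem) : Prop :=
  Finite V ∧ G.Connected ∧ Nat.card V + Nat.card R.Face = Nat.card G.edgeSet + 2

/-- A plane triangulation: every face has length 3. -/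
def IsPlaneTriangulation (R : G.RotationSystem) : Prop :=
  R.IsPlane ∧ ∀ φ, R.faceLength φ = 3

/-- A plane quadrangulation: every face has length 4. -/
def IsPlaneQuadrangulation (R : G.RotationSystem) : Prop :=
  R.IsPlane ∧ ∀ φ, R.faceLength φ = 4

/-- The dual multigraph: its vertices are the faces, and every edge `e` of `G` is also an edge of
the dual, joining the faces on the two sides of `e`. -/
def dual (R : G.RotationSystem) : Graph R.Face (Sym2 V) where
  vertexSet := Set.univ
  IsLink e φ ψ := ∃ d : G.Dart, d.edge = e ∧ R.face d = φ ∧ R.face d.symm = ψ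
  isLink_symm := by
    rintro e -
    refine ⟨?_⟩
    rintro φ ψ ⟨d, rfl, rfl, rfl⟩
    exact ⟨d.symm, d.edge_symm, rfl, by rw [Dart.symm_symm]⟩
  eq_or_eq_of_isLink_of_isLink := by
    rintro e φ ψ χ ω ⟨d, rfl, rfl, rfl⟩ ⟨d', h, rfl, rfl⟩
    rcases (dart_edge_eq_iff d' d).1 h with rfl | rfl
    · exact Or.inl rfl
    · right
      rw [Dart.symm_symm]
  left_mem_of_isLink := fun _ _ _ _ => Set.mem_univ _

/-- `R'` is the rotation system that `R` induces on the subgraph `H` of `G`, i.e. the embedding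
obtained from that of `G` by erasing the edges not in `H`: the successor of a dart `d` of `H` is
the first dart of `H` met after `d` in the rotation of `R`. (This determines `R'`.) -/
def Induces {H : SimpleGraph V} (R : G.RotationSystem) (hle : H ≤ G)
    (R' : H.RotationSystem) : Prop :=
  ∀ d : H.Dart, ∃ k : ℕ, 0 < k ∧
    R.next^[k] ((Hom.ofLE hle).mapDart d) = (Hom.ofLE hle).mapDart (R'.next d) ∧
    ∀ j, 0 < j → j < k → (R.next^[j] ((Hom.ofLE hle).mapDart d)).edge ∉ H.edgeSet

end RotationSystem

end SimpleGraph

/-!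
The edges of `S` are those whose duals are missing from the 2-factor `C`. The dual of a triangulation
is 3-regular and loopless, so each triangle has exactly one side in `S`
(`SimpleGraph.RotationSystem.IsDualMatching`); this is the perfect matching.

*Topology.* Euler's formula enters through linear algebra over `ZMod 2`. The vertex-edge and
face-edge incidence matrices have orthogonal rows, and their ranks are at least `|V| - 1` and
`|F| - 1` because `G` and its dual are connected. By Euler's formula these ranks add up to at
least `|E|`, so every cycle is the boundary of a set of faces (`IsPlane.exists_boundary`), and every
edge function with zero sum along each facial walk is a coboundary (`IsPlane.exists_coboundary`).

*Bipartiteness.* Each facial walk has two edges outside `S`, so the indicator function of the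
complement of `S` is the coboundary of a function on the vertices, which is a 2-colouring of `G - S`.

*1-selection.* A cycle inside `S` is the boundary of a set of faces that is a union of components of
`C`. There are at most two components, each of them being a cycle, and the union of all of them has
empty boundary; so `S` carries at most one nonzero cycle. Hence `T ⊆ S` has at most as many elements
as it has ends, and Hall's theorem assigns to each edge of `S` an end of its own.

*Quadrangulation.* Two consecutive edges around a vertex are never both in `S`, so the inherited
rotation skips at most one dart at a time. Its facial walks run around pairs of triangles that
share an edge of `S`, and Euler's formula for `G - S` follows by counting darts.

*Robust chromatic number.* If `|V| ≥ 4`, then `|E| = 3|V| - 6 > |V|`, so no 1-selection removes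
all the edges.
-/

theorem Set.mem_of_encard_inter_eq_two {α : Type*} {a b c : α} {s : Set α} (hab : a ≠ b)
    (hbc : b ≠ c) (hac : a ≠ c) (hs : ({a, b, c} ∩ s).encard = 2) :
    (a ∉ s → b ∈ s ∧ c ∈ s) ∧ (a ∈ s → b ∈ s → c ∉ s) := by
  have hone : ∀ x : α, ¬ {a, b, c} ∩ s ⊆ {x} := fun x hx => by
    have := Set.encard_le_encard hx
    rw [hs, Set.encard_singleton] at this
    exact absurd this (by decide)
  refine ⟨fun ha => ⟨?_, ?_⟩, fun ha hb hc => ?_⟩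
  · by_contra hb
    refine hone c ?_
    rintro x ⟨rfl | rfl | rfl, hx⟩
    exacts [absurd hx ha, absurd hx hb, rfl]
  · by_contra hc
    refine hone b ?_
    rintro x ⟨rfl | rfl | rfl, hx⟩
    exacts [absurd hx ha, rfl, absurd hx hc]
  · have h3 : ({a, b, c} : Set α) ∩ s = {a, b, c} := by
      refine Set.inter_eq_left.2 ?_
      rintro x (rfl | rfl | rfl) <;> assumption
    rw [h3, Set.encard_eq_three.2 ⟨a, b, c, hab, hac, hbc, rfl⟩] at hs
    exact absurd hs (by decide)

namespace SimpleGraph.RotationSystem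

variable {V : Type*} {G : SimpleGraph V} (R : G.RotationSystem)

/-! ### Facial walks -/

theorem faceStep_apply (d : G.Dart) : R.faceStep d = R.next d.symm := rfl

theorem next_eq_faceStep_symm (d : G.Dart) : R.next d = R.faceStep d.symm := by
  rw [faceStep_apply, Dart.symm_symm]

@[simp]
theorem faceStep_fst (d : G.Dart) : (R.faceStep d).fst = d.snd := R.next_fst d.symm

theorem face_eq_iff (d d' : G.Dart) : R.face d = R.face d' ↔ R.faceStep.SameCycle d d' :=
  Quotient.eq (r := Equiv.Perm.SameCycle.setoid R.faceStep)

@[simp]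
theorem face_faceStep (d : G.Dart) : R.face (R.faceStep d) = R.face d := by
  rw [face_eq_iff, Equiv.Perm.sameCycle_apply_left]

theorem exists_face_eq (φ : R.Face) : ∃ d, R.face d = φ := Quotient.exists_rep φ

instance finite_face [Finite G.Dart] : Finite R.Face :=
  Finite.of_surjective R.face R.exists_face_eq

theorem faceLength_face [Finite G.Dart] (d : G.Dart) :
    R.faceLength (R.face d) = Function.minimalPeriod R.faceStep d := by
  have := Fintype.ofFinite G.Dart
  classical
  have h : (R.faceStep • · : G.Dart → G.Dart) = R.faceStep := rfl
  rw [← h, MulAction.minimalPeriod_eq_card, ← Nat.card_eq_fintype_card]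
  refine Nat.card_congr (Equiv.subtypeEquivRight fun d' => ?_)
  rw [eq_comm, face_eq_iff, MulAction.mem_orbit_iff]
  constructor
  · rintro ⟨i, hi⟩
    exact ⟨⟨R.faceStep ^ i, i, rfl⟩, hi⟩
  · rintro ⟨⟨_, i, rfl⟩, hi⟩
    exact ⟨i, hi⟩

/-! ### Triangular faces -/

/-- All facial walks have length three. -/
def IsTriangular : Prop := ∀ d, R.faceStep (R.faceStep (R.faceStep d)) = d

variable {R}

theorem IsPlane.finite_dart (h : R.IsPlane) : Finite G.Dart :=
  have := h.1
  Finite.of_injective _ Dart.toProd_injective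

theorem IsPlaneTriangulation.isTriangular (h : R.IsPlaneTriangulation) : R.IsTriangular := by
  have := h.1.finite_dart
  intro d
  have h3 : Function.minimalPeriod R.faceStep d = 3 := by rw [← faceLength_face, h.2]
  have := Function.isPeriodicPt_minimalPeriod R.faceStep d
  rw [h3] at this
  exact this

namespace IsTriangular

variable (h : R.IsTriangular)
include h

theorem face_eq_iff (d d' : G.Dart) :
    R.face d' = R.face d ↔ d' = d ∨ d' = R.faceStep d ∨ d' = R.faceStep (R.faceStep d) := by
  constructor
  · rw [eq_comm, RotationSystem.face_eq_iff]
    rintro ⟨i, rfl⟩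
    have h3 : R.faceStep ^ (3 : ℤ) = 1 := by
      ext1 d
      exact h d
    have hi : R.faceStep ^ i = R.faceStep ^ (i % 3) := by
      conv_lhs => rw [← Int.emod_add_mul_ediv i 3, zpow_add, zpow_mul, h3, one_zpow, mul_one]
    rw [hi]
    obtain h0 | h1 | h2 : i % 3 = 0 ∨ i % 3 = 1 ∨ i % 3 = 2 := by omega
    · rw [h0]; exact Or.inl rfl
    · rw [h1]; exact Or.inr (Or.inl rfl)
    · rw [h2]; exact Or.inr (Or.inr rfl)
  · rintro (rfl | rfl | rfl) <;> simp

theorem snd_faceStep_faceStep (d : G.Dart) :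
    (R.faceStep (R.faceStep d)).snd = d.fst := by
  rw [← faceStep_fst, h d]

/-- The dual has no loops. -/
theorem face_symm_ne (d : G.Dart) : R.face d.symm ≠ R.face d := by
  intro hd
  rcases (h.face_eq_iff d d.symm).1 hd with h1 | h1 | h1
  · exact d.symm_ne h1
  · have h2 := h.snd_faceStep_faceStep d
    have h3 : (R.faceStep d).snd = d.fst := by rw [← h1]; rfl
    rw [← h3, ← R.faceStep_fst (R.faceStep d)] at h2
    exact (R.faceStep (R.faceStep d)).fst_ne_snd h2.symm
  · have h2 := R.faceStep_fst (R.faceStep d)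
    rw [← h1] at h2
    have h3 := R.faceStep_fst d
    exact (R.faceStep d).fst_ne_snd (h3.trans h2)

theorem eq_of_edge_eq {d d' : G.Dart} (hf : R.face d = R.face d') (he : d.edge = d'.edge) :
    d = d' := by
  rcases (dart_edge_eq_iff d d').1 he with h1 | rfl
  · exact h1
  · exact absurd hf (h.face_symm_ne d')

theorem edge_ne_edge_faceStep (d : G.Dart) : d.edge ≠ (R.faceStep d).edge := by
  intro he
  have h1 := h.eq_of_edge_eq (R.face_faceStep d).symm he
  have h2 := R.faceStep_fst d
  rw [← h1] at h2
  exact d.fst_ne_snd h2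

theorem edge_ne_edge_faceStep_faceStep (d : G.Dart) :
    d.edge ≠ (R.faceStep (R.faceStep d)).edge := by
  have := h.edge_ne_edge_faceStep (R.faceStep (R.faceStep d))
  rw [h d] at this
  exact this.symm

theorem dual_inc_iff (d : G.Dart) (e : Sym2 V) :
    R.dual.Inc e (R.face d) ↔
      e = d.edge ∨ e = (R.faceStep d).edge ∨ e = (R.faceStep (R.faceStep d)).edge := by
  constructor
  · rintro ⟨ψ, d', rfl, h1, -⟩
    rcases (h.face_eq_iff d d').1 h1 with rfl | rfl | rfl <;> simp
  · rintro (rfl | rfl | rfl)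
    · exact ⟨_, d, rfl, rfl, rfl⟩
    · exact ⟨_, R.faceStep d, rfl, by simp, rfl⟩
    · exact ⟨_, R.faceStep (R.faceStep d), rfl, by simp, rfl⟩

theorem dual_loopSet (φ : R.Face) : R.dual.loopSet φ = ∅ := by
  ext e
  simp only [Graph.mem_loopSet, Set.mem_empty_iff_false, iff_false]
  rintro ⟨d, -, h1, h2⟩
  exact h.face_symm_ne d (h2.trans h1.symm)

end IsTriangular

/-! ### Edges outside a 2-factor of the dual -/

variable (R) in
/-- Every triangular face has exactly one side in `S`: the dual edges of `S` form a perfect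
matching of the dual. The condition is stated along the facial walk `d`, `faceStep d`,
`faceStep (faceStep d)` of each face. -/
structure IsDualMatching (S : Set (Sym2 V)) : Prop where
  subset : S ⊆ G.edgeSet
  next_notMem : ∀ d : G.Dart, d.edge ∈ S → (R.faceStep d).edge ∉ S
  prev_notMem : ∀ d : G.Dart, d.edge ∈ S → (R.faceStep (R.faceStep d)).edge ∉ S
  mem_of_notMem : ∀ d : G.Dart, d.edge ∉ S → (R.faceStep d).edge ∉ S →
    (R.faceStep (R.faceStep d)).edge ∈ S

theorem IsDualMatching.exists_face_eq {S : Set (Sym2 V)} (hS : R.IsDualMatching S) (φ : R.Face) :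
    ∃ d : G.Dart, R.face d = φ ∧ d.edge ∈ S := by
  obtain ⟨d, rfl⟩ := R.exists_face_eq φ
  by_cases h0 : d.edge ∈ S
  · exact ⟨d, rfl, h0⟩
  by_cases h1 : (R.faceStep d).edge ∈ S
  · exact ⟨_, by simp, h1⟩
  · exact ⟨_, by simp, hS.mem_of_notMem d h0 h1⟩

theorem IsDualMatching.ncard_notMem {S : Set (Sym2 V)} (hS : R.IsDualMatching S)
    (h : R.IsTriangular) (φ : R.Face) :
    {d : G.Dart | R.face d = φ ∧ d.edge ∉ S}.ncard = 2 := by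
  obtain ⟨d, rfl, hd⟩ := hS.exists_face_eq φ
  have h1 := hS.next_notMem d hd
  have h2 := hS.prev_notMem d hd
  have : {d' : G.Dart | R.face d' = R.face d ∧ d'.edge ∉ S} =
      {R.faceStep d, R.faceStep (R.faceStep d)} := by
    ext d'
    simp only [Set.mem_ofPred_eq, h.face_eq_iff, Set.mem_insert_iff, Set.mem_singleton_iff]
    constructor
    · rintro ⟨rfl | h | h, h'⟩ <;> tauto
    · rintro (rfl | rfl) <;> tauto
  rw [this, Set.ncard_pair]
  intro he
  exact h.edge_ne_edge_faceStep (R.faceStep d) (congrArg Dart.edge he)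

variable {C : Graph R.Face (Sym2 V)}

theorem IsTriangular.incidenceSet_of_le (h : R.IsTriangular) (hC : C ≤ R.dual) (d : G.Dart) :
    C.incidenceSet (R.face d) =
      {d.edge, (R.faceStep d).edge, (R.faceStep (R.faceStep d)).edge} ∩ C.edgeSet := by
  ext e
  simp only [Graph.mem_incidenceSet, Set.mem_inter_iff, Set.mem_insert_iff, Set.mem_singleton_iff]
  rw [← h.dual_inc_iff]
  exact ⟨fun he => ⟨he.mono hC, he.edge_mem⟩, fun he => (hC.inc_congr he.2).2 he.1⟩

theorem IsTriangular.loopSet_of_le (h : R.IsTriangular) (hC : C ≤ R.dual) (φ : R.Face) :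
    C.loopSet φ = ∅ :=
  Set.subset_empty_iff.1 fun e he => by
    rw [← h.dual_loopSet φ]
    exact Graph.IsLoopAt.mono hC he

theorem IsTriangular.isDualMatching (h : R.IsTriangular) (hC : C.IsFactor R.dual 2) :
    R.IsDualMatching (G.edgeSet \ C.edgeSet) := by
  have key : ∀ d : G.Dart, ({d.edge, (R.faceStep d).edge, (R.faceStep (R.faceStep d)).edge} ∩
      C.edgeSet).encard = 2 := by
    intro d
    have := hC.2 (R.face d) (by rw [hC.1.vertexSet_eq]; exact Set.mem_univ _)
    rwa [Graph.factorDegree, h.loopSet_of_le hC.1.le, Set.encard_empty, add_zero,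
      h.incidenceSet_of_le hC.1.le] at this
  have key' : ∀ d : G.Dart,
      (d.edge ∉ C.edgeSet → (R.faceStep d).edge ∈ C.edgeSet ∧
        (R.faceStep (R.faceStep d)).edge ∈ C.edgeSet) ∧
      (d.edge ∈ C.edgeSet → (R.faceStep d).edge ∈ C.edgeSet →
        (R.faceStep (R.faceStep d)).edge ∉ C.edgeSet) := by
    intro d
    exact Set.mem_of_encard_inter_eq_two (h.edge_ne_edge_faceStep d)
      (h.edge_ne_edge_faceStep (R.faceStep d)) (h.edge_ne_edge_faceStep_faceStep d) (key d)
  refine ⟨Set.sdiff_subset, fun d hd => ?_, fun d hd => ?_, fun d h0 h1 => ?_⟩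
  · exact fun h' => h'.2 ((key' d).1 hd.2).1
  · exact fun h' => h'.2 ((key' d).1 hd.2).2
  · have m0 : d.edge ∈ C.edgeSet := by by_contra hc; exact h0 ⟨d.edge_mem, hc⟩
    have m1 : (R.faceStep d).edge ∈ C.edgeSet := by
      by_contra hc; exact h1 ⟨Dart.edge_mem _, hc⟩
    exact ⟨Dart.edge_mem _, (key' d).2 m0 m1⟩

theorem IsTriangular.isFactor_one (h : R.IsTriangular) (hC : C.IsFactor R.dual 2) :
    (R.dual.deleteEdges C.edgeSet).IsFactor R.dual 1 := by
  have hS := h.isDualMatching hC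
  refine ⟨⟨Graph.deleteEdges_le, rfl⟩, fun φ _ => ?_⟩
  obtain ⟨d, rfl, hd⟩ := hS.exists_face_eq φ
  have h1 := hS.next_notMem d hd
  have h2 := hS.prev_notMem d hd
  have : (R.dual.deleteEdges C.edgeSet).incidenceSet (R.face d) = {d.edge} := by
    ext e
    simp only [Graph.mem_incidenceSet, Graph.deleteEdges_inc, h.dual_inc_iff,
      Set.mem_singleton_iff]
    constructor
    · rintro ⟨rfl | rfl | rfl, he⟩
      · rfl
      · exact absurd ⟨Dart.edge_mem _, he⟩ h1
      · exact absurd ⟨Dart.edge_mem _, he⟩ h2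
    · rintro rfl
      exact ⟨Or.inl rfl, hd.2⟩
  rw [Graph.factorDegree, h.loopSet_of_le Graph.deleteEdges_le, this, Set.encard_empty,
    Set.encard_singleton, add_zero, Nat.cast_one]

end SimpleGraph.RotationSystem

/-! ### Exactness of the mod 2 chain complex -/

theorem Matrix.exists_vecMul_eq_of_mulVec_eq_zero {K ι κ ε : Type*} [Field K] [Fintype ι]
    [Fintype κ] [Fintype ε] {M : Matrix ι ε K} {N : Matrix κ ε K} (hMN : M * N.transpose = 0)
    (hr : Fintype.card ε ≤ M.rank + N.rank) {z : ε → K} (hz : M.mulVec z = 0) :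
    ∃ x, Matrix.vecMul x N = z := by
  have hle : LinearMap.range N.transpose.mulVecLin ≤ LinearMap.ker M.mulVecLin := by
    rintro _ ⟨x, rfl⟩
    rw [LinearMap.mem_ker, Matrix.mulVecLin_apply, Matrix.mulVecLin_apply, Matrix.mulVec_mulVec,
      hMN, Matrix.zero_mulVec]
  have h1 := M.mulVecLin.finrank_range_add_finrank_ker
  have h2 : Module.finrank K (LinearMap.range N.transpose.mulVecLin) = N.rank := N.rank_transpose
  have h3 : Module.finrank K (LinearMap.range M.mulVecLin) = M.rank := rfl
  rw [Module.finrank_fintype_fun_eq_card] at h1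
  have heq := Submodule.eq_of_le_of_finrank_le hle (by omega)
  have hz' : z ∈ LinearMap.ker M.mulVecLin := hz
  rw [← heq] at hz'
  obtain ⟨x, rfl⟩ := hz'
  exact ⟨x, (Matrix.mulVec_transpose N x).symm⟩

/-- If only constant vectors are in the left kernel of `M`, then the rows of `M` satisfy at most
one linear relation. -/
theorem Matrix.card_le_rank_add_one {K ι ε : Type*} [Field K] [Fintype ι] [Fintype ε]
    {M : Matrix ι ε K} (h : ∀ x, Matrix.vecMul x M = 0 → ∀ i j, x i = x j) :
    Fintype.card ι ≤ M.rank + 1 := by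
  have h1 := M.transpose.mulVecLin.finrank_range_add_finrank_ker
  have h2 : Module.finrank K (LinearMap.range M.transpose.mulVecLin) = M.rank := M.rank_transpose
  rw [Module.finrank_fintype_fun_eq_card, h2] at h1
  have h3 : Module.finrank K (LinearMap.ker M.transpose.mulVecLin) ≤ 1 := by
    refine (Submodule.finrank_mono (t := K ∙ (1 : ι → K)) fun x hx => ?_).trans
      ((finrank_span_le_card _).trans (by simp))
    rw [LinearMap.mem_ker, Matrix.mulVecLin_apply, Matrix.mulVec_transpose] at hx
    rw [Submodule.mem_span_singleton]
    rcases isEmpty_or_nonempty ι with hι | ⟨⟨i⟩⟩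
    · exact ⟨0, Subsingleton.elim _ _⟩
    · exact ⟨x i, funext fun j => by simpa using h x hx i j⟩
  omega

namespace SimpleGraph.RotationSystem

open scoped Classical

variable {V : Type*} {G : SimpleGraph V} (R : G.RotationSystem)

theorem _root_.SimpleGraph.Dart.mem_edge_iff (d : G.Dart) (v : V) :
    v ∈ d.edge ↔ v = d.fst ∨ v = d.snd := Sym2.mem_iff

theorem _root_.SimpleGraph.exists_dart_edge_eq (e : G.edgeSet) : ∃ d : G.Dart, d.edge = e := by
  obtain ⟨e, he⟩ := e
  induction e with
  | _ u v => exact ⟨⟨(u, v), he⟩, rfl⟩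

variable (G) in
/-- The vertex-edge incidence matrix modulo 2. -/
noncomputable def vertexMatrix : Matrix V G.edgeSet (ZMod 2) :=
  Matrix.of fun v e => if v ∈ (e : Sym2 V) then 1 else 0

/-- The face-edge incidence matrix modulo 2: the entry at `(φ, e)` is the number of darts of `e`
on the facial walk `φ`. -/
noncomputable def faceMatrix [Fintype G.Dart] : Matrix R.Face G.edgeSet (ZMod 2) :=
  Matrix.of fun φ e => ∑ d : G.Dart, if d.edge = e ∧ R.face d = φ then 1 else 0

theorem vertexMatrix_edge (d : G.Dart) (v : V) :
    vertexMatrix G v ⟨d.edge, d.edge_mem⟩ =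
      (if v = d.fst then 1 else 0) + (if v = d.snd then 1 else 0) := by
  have := d.fst_ne_snd
  simp only [vertexMatrix, Matrix.of_apply, Dart.mem_edge_iff]
  by_cases h1 : v = d.fst
  · have h2 : v ≠ d.snd := fun h => this (h1.symm.trans h)
    simp [h1, this]
  · simp [h1]

/-- The coboundary of a function on the vertices. -/
theorem vecMul_vertexMatrix [Fintype V] (g : V → ZMod 2) (d : G.Dart) :
    Matrix.vecMul g (vertexMatrix G) ⟨d.edge, d.edge_mem⟩ = g d.fst + g d.snd := by
  simp [Matrix.vecMul, dotProduct, vertexMatrix_edge, mul_add, Finset.sum_add_distrib]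

theorem sum_dart_edge [Fintype G.Dart] {K : Type*} [AddCommMonoid K] (f : G.Dart → K) (d : G.Dart) :
    (∑ d' : G.Dart, if d'.edge = d.edge then f d' else 0) = f d + f d.symm := by
  have : (Finset.univ.filter fun d' : G.Dart => d'.edge = d.edge) = {d, d.symm} := by
    ext d'
    simp [dart_edge_eq_iff]
  rw [← Finset.sum_filter, this, Finset.sum_pair d.symm_ne.symm]

/-- The boundary of a set of faces. -/
theorem vecMul_faceMatrix [Fintype G.Dart] [Fintype R.Face] (x : R.Face → ZMod 2) (d : G.Dart) :
    Matrix.vecMul x R.faceMatrix ⟨d.edge, d.edge_mem⟩ = x (R.face d) + x (R.face d.symm) := by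
  rw [← sum_dart_edge (fun d => x (R.face d))]
  simp only [Matrix.vecMul, dotProduct, faceMatrix, Matrix.of_apply, Finset.mul_sum]
  rw [Finset.sum_comm]
  refine Finset.sum_congr rfl fun d' _ => ?_
  by_cases h : d'.edge = d.edge <;> simp [h]

/-- The sum of an edge function along the facial walks. -/
theorem faceMatrix_mulVec [Fintype G.Dart] [Fintype G.edgeSet] (z : G.edgeSet → ZMod 2)
    (φ : R.Face) :
    R.faceMatrix.mulVec z φ =
      ∑ d : G.Dart, if R.face d = φ then z ⟨d.edge, d.edge_mem⟩ else 0 := by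
  simp only [Matrix.mulVec, dotProduct, faceMatrix, Matrix.of_apply, Finset.sum_mul]
  rw [Finset.sum_comm]
  refine Finset.sum_congr rfl fun d _ => ?_
  rw [Finset.sum_eq_single ⟨d.edge, d.edge_mem⟩]
  · simp
  · intro e _ he
    have : d.edge ≠ e := fun h => he (Subtype.ext h.symm)
    simp [this]
  · simp

/-- A facial walk is closed: it enters a vertex as often as it leaves it. -/
theorem faceMatrix_mul_vertexMatrix_transpose [Fintype G.Dart] [Fintype G.edgeSet] :
    R.faceMatrix * (vertexMatrix G).transpose = 0 := by
  ext φ v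
  have := R.faceMatrix_mulVec (fun e => vertexMatrix G v e) φ
  rw [Matrix.zero_apply]
  refine this.trans ?_
  have hshift : (∑ d : G.Dart, if R.face d = φ ∧ v = d.snd then (1 : ZMod 2) else 0) =
      ∑ d : G.Dart, if R.face d = φ ∧ v = d.fst then 1 else 0 := by
    rw [← Equiv.sum_comp R.faceStep (fun d => if R.face d = φ ∧ v = d.fst then (1 : ZMod 2) else 0)]
    simp
  simp only [vertexMatrix_edge]
  calc _ = ∑ d : G.Dart, ((if R.face d = φ ∧ v = d.fst then (1 : ZMod 2) else 0) +
        if R.face d = φ ∧ v = d.snd then 1 else 0) := by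
        refine Finset.sum_congr rfl fun d _ => ?_
        by_cases h : R.face d = φ <;> simp [h]
    _ = 0 := by
        rw [Finset.sum_add_distrib, hshift]
        exact CharTwo.add_self_eq_zero _

variable {R}

/-- On a connected graph, a function of the vertices that does not change along edges is
constant. -/
theorem _root_.SimpleGraph.Connected.eq_of_forall_adj {α : Type*} (hG : G.Connected) {g : V → α}
    (hg : ∀ u v, G.Adj u v → g u = g v) (u v : V) : g u = g v := by
  obtain ⟨p⟩ := hG.preconnected u v
  induction p with
  | nil => rfl
  | cons h _ ih => exact (hg _ _ h).trans ih

/-- The dual of a connected graph is connected: a function of the faces that does not change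
across edges is constant. -/
theorem eq_of_forall_face_eq {α : Type*} (hG : G.Connected) {x : R.Face → α}
    (hx : ∀ d : G.Dart, x (R.face d) = x (R.face d.symm)) (φ ψ : R.Face) : x φ = x ψ := by
  have hnext : ∀ d, x (R.face (R.next d)) = x (R.face d) := fun d => by
    rw [next_eq_faceStep_symm, face_faceStep, hx d]
  have hcycle : ∀ d d' : G.Dart, d.fst = d'.fst → x (R.face d) = x (R.face d') := by
    intro d d' h
    obtain ⟨i, rfl⟩ := R.sameCycle_of_fst_eq d d' h
    induction i with
    | zero => rfl
    | succ n ih =>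
      rw [add_comm, zpow_add, zpow_one, Equiv.Perm.mul_apply, hnext]
      exact ih (h.trans (by rw [add_comm, zpow_add, zpow_one, Equiv.Perm.mul_apply, R.next_fst]))
    | pred n ih =>
      have h1 : (R.next ^ (-(n : ℤ))) d = R.next ((R.next ^ (-(n : ℤ) - 1)) d) := by
        rw [← Equiv.Perm.mul_apply, ← zpow_one_add]; simp
      rw [← hnext ((R.next ^ (-(n : ℤ) - 1)) d), ← h1]
      exact ih (h.trans (by rw [h1, R.next_fst]))
  obtain ⟨d, rfl⟩ := R.exists_face_eq φ
  obtain ⟨d', rfl⟩ := R.exists_face_eq ψ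
  -- The common value of `x` around a vertex, encoded as a predicate on values.
  have key := hG.eq_of_forall_adj (g := fun v => fun a => ∀ d : G.Dart, d.fst = v →
    x (R.face d) = a) (fun u v huv => by
      funext a
      have h1 : x (R.face ⟨(u, v), huv⟩) = x (R.face ⟨(v, u), huv.symm⟩) := hx ⟨(u, v), huv⟩
      refine propext ⟨fun h d hd => ?_, fun h d hd => ?_⟩
      · rw [← h ⟨(u, v), huv⟩ rfl, h1]
        exact hcycle _ _ hd
      · rw [← h ⟨(v, u), huv.symm⟩ rfl, ← h1]
        exact hcycle _ _ hd) d.fst d'.fst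
  have := congrFun key (x (R.face d'))
  exact (iff_of_eq this).2 (fun d'' h => hcycle _ _ h) d rfl

theorem IsPlane.card_edgeSet_le_rank [Fintype V] [Fintype G.Dart] [Fintype G.edgeSet]
    [Fintype R.Face] (h : R.IsPlane) :
    Fintype.card G.edgeSet ≤ (vertexMatrix G).rank + R.faceMatrix.rank := by
  have hV : Fintype.card V ≤ (vertexMatrix G).rank + 1 := by
    refine Matrix.card_le_rank_add_one fun g hg => h.2.1.eq_of_forall_adj fun u v huv => ?_
    have := congrFun hg ⟨s(u, v), huv⟩
    exact CharTwo.add_eq_zero.1 ((vecMul_vertexMatrix g ⟨(u, v), huv⟩).symm.trans this)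
  have hF : Fintype.card R.Face ≤ R.faceMatrix.rank + 1 := by
    refine Matrix.card_le_rank_add_one fun x hx => eq_of_forall_face_eq h.2.1 fun d => ?_
    have := congrFun hx ⟨d.edge, d.edge_mem⟩
    exact CharTwo.add_eq_zero.1 ((R.vecMul_faceMatrix x d).symm.trans this)
  have h3 := h.2.2
  simp only [Nat.card_eq_fintype_card] at h3
  omega

/-- Every edge set meeting each facial walk evenly is a cut. -/
theorem IsPlane.exists_coboundary [Fintype V] [Fintype G.Dart] [Fintype G.edgeSet]
    (h : R.IsPlane) {z : G.edgeSet → ZMod 2} (hz : R.faceMatrix.mulVec z = 0) :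
    ∃ g, Matrix.vecMul g (vertexMatrix G) = z := by
  have := Fintype.ofFinite R.Face
  refine Matrix.exists_vecMul_eq_of_mulVec_eq_zero R.faceMatrix_mul_vertexMatrix_transpose ?_ hz
  rw [add_comm]
  exact h.card_edgeSet_le_rank

/-- Every cycle is the boundary of a set of faces. -/
theorem IsPlane.exists_boundary [Fintype V] [Fintype G.Dart] [Fintype G.edgeSet] [Fintype R.Face]
    (h : R.IsPlane) {z : G.edgeSet → ZMod 2} (hz : (vertexMatrix G).mulVec z = 0) :
    ∃ x, Matrix.vecMul x R.faceMatrix = z := by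
  refine Matrix.exists_vecMul_eq_of_mulVec_eq_zero ?_ h.card_edgeSet_le_rank hz
  rw [← Matrix.transpose_transpose (vertexMatrix G), ← Matrix.transpose_mul,
    R.faceMatrix_mul_vertexMatrix_transpose, Matrix.transpose_zero]

/-! ### Two-colouring -/

theorem IsDualMatching.isBipartite {S : Set (Sym2 V)} (hS : R.IsDualMatching S)
    (hR : R.IsPlaneTriangulation) : (G.deleteEdges S).IsBipartite := by
  have := hR.1.1
  have := hR.1.finite_dart
  have := Fintype.ofFinite V
  have := Fintype.ofFinite G.Dart
  have := Fintype.ofFinite G.edgeSet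
  -- Each facial walk has two edges outside `S`, so the complement of `S` is a cut.
  obtain ⟨g, hg⟩ := hR.1.exists_coboundary
    (z := fun e => if (e : Sym2 V) ∈ S then 0 else 1) (by
      funext φ
      have h2 := hS.ncard_notMem hR.isTriangular φ
      rw [faceMatrix_mulVec, Pi.zero_apply]
      calc _ = ∑ d : G.Dart, if R.face d = φ ∧ d.edge ∉ S then (1 : ZMod 2) else 0 := by
            refine Finset.sum_congr rfl fun d _ => ?_
            by_cases h : R.face d = φ <;> by_cases h' : d.edge ∈ S <;> simp [h, h']
        _ = 0 := by
            rw [Finset.sum_boole, ← Set.ncard_coe_finset, Finset.coe_filter_univ, h2]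
            rfl)
  refine ⟨Coloring.mk (α := ZMod 2) g fun {u v} huv he => ?_⟩
  rw [deleteEdges_adj] at huv
  have h1 := (vecMul_vertexMatrix g ⟨(u, v), huv.1⟩).symm.trans (congrFun hg _)
  have h2 : g u + g v = 1 := h1.trans (if_neg huv.2)
  rw [he, CharTwo.add_self_eq_zero] at h2
  exact zero_ne_one h2

end SimpleGraph.RotationSystem

/-! ### Components of a 2-factor -/

namespace Graph

variable {α β : Type*} {G : Graph α β}

/-- The component of `φ` in `G`. -/
protected def component (G : Graph α β) (φ : α) : Graph α β :=
  G.induce {ψ | Relation.ReflTransGen G.Adj φ ψ}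

theorem mem_vertexSet_component {φ ψ : α} :
    ψ ∈ (G.component φ).vertexSet ↔ Relation.ReflTransGen G.Adj φ ψ := Iff.rfl

theorem vertexSet_component_subset {φ : α} (hφ : φ ∈ G.vertexSet) :
    (G.component φ).vertexSet ⊆ G.vertexSet := by
  intro ψ hψ
  rcases Relation.ReflTransGen.cases_tail hψ with rfl | ⟨χ, -, h⟩
  · exact hφ
  · exact h.right_mem

theorem component_isClosedSubgraph {φ : α} (hφ : φ ∈ G.vertexSet) :
    (G.component φ).IsClosedSubgraph G :=
  IsClosedSubgraph.mk' (induce_le (vertexSet_component_subset hφ)) <| by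
    rintro e x ⟨y, hxy⟩ hx
    exact ⟨x, y, hxy, hx, Relation.ReflTransGen.tail hx ⟨e, hxy⟩⟩

theorem component_isCycleGraph [Finite α] (hG : G.IsRegularMultigraph 2) {φ : α}
    (hφ : φ ∈ G.vertexSet) : (G.component φ).IsCycleGraph where
  finite := Set.toFinite _
  nonempty := ⟨φ, Relation.ReflTransGen.refl⟩
  connected := by
    have hc := component_isClosedSubgraph hφ
    intro x hx y hy
    have hxy : Relation.ReflTransGen G.Adj x y :=
      (Std.Symm.symm (r := Relation.ReflTransGen G.Adj) _ _ hx).trans hy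
    clear hy
    induction hxy using Relation.ReflTransGen.head_induction_on with
    | refl => exact Relation.ReflTransGen.refl
    | head h _ ih =>
      exact Relation.ReflTransGen.head ((hc.adj_congr hx).2 h) (ih ((hc.mem_iff_of_adj h).1 hx))
  regular := by
    have hc := component_isClosedSubgraph hφ
    intro x hx
    have h1 : (G.component φ).incidenceSet x = G.incidenceSet x :=
      Set.ext fun e => hc.inc_congr hx
    have h2 : (G.component φ).loopSet x = G.loopSet x :=
      Set.ext fun e => hc.isLink_congr hx
    rw [factorDegree, h1, h2]
    exact hG x (vertexSet_component_subset hφ hx)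

/-- A 2-regular multigraph with at most two cycles has at most two components. -/
theorem exists_reflTransGen_of_encard_le_two [Finite α] (hG : G.IsRegularMultigraph 2)
    (hcycles : G.cycleSubgraphs.encard ≤ 2) {a b c : α} (ha : a ∈ G.vertexSet)
    (hb : b ∈ G.vertexSet) (hc : c ∈ G.vertexSet) (hab : ¬ Relation.ReflTransGen G.Adj a b) :
    Relation.ReflTransGen G.Adj a c ∨ Relation.ReflTransGen G.Adj b c := by
  by_contra! hcon
  have hne : ∀ {x y : α}, ¬ Relation.ReflTransGen G.Adj x y → G.component x ≠ G.component y := by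
    intro x y hxy heq
    refine hxy (mem_vertexSet_component.1 ?_)
    rw [heq]
    exact Relation.ReflTransGen.refl
  have hmem : ∀ {x : α}, x ∈ G.vertexSet → G.component x ∈ G.cycleSubgraphs := fun hx =>
    ⟨(component_isClosedSubgraph hx).le, component_isCycleGraph hG hx⟩
  have h3 : ({G.component a, G.component b, G.component c} : Set (Graph α β)).encard = 3 :=
    Set.encard_eq_three.2 ⟨_, _, _, hne hab, hne hcon.1, hne hcon.2, rfl⟩
  have hsub : ({G.component a, G.component b, G.component c} : Set (Graph α β)) ⊆
      G.cycleSubgraphs := by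
    rintro _ (rfl | rfl | rfl)
    exacts [hmem ha, hmem hb, hmem hc]
  have := (Set.encard_le_encard hsub).trans hcycles
  rw [h3] at this
  exact absurd this (by decide)

end Graph

/-! ### Selecting the edges outside the 2-factor -/

namespace SimpleGraph

open scoped Classical

variable {V : Type*} {G : SimpleGraph V}

/-- A set of edges of which every nonempty finite subset is at most as large as the set of its ends
is a 1-selection set, by Hall's theorem. -/
theorem isOneSelectionSet_of_card_le [Fintype V] {S : Set (Sym2 V)} (hS : S ⊆ G.edgeSet)
    (h : ∀ T : Finset S, T.Nonempty →
      T.card ≤ (T.biUnion fun e => Finset.univ.filter (· ∈ (e : Sym2 V))).card) :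
    G.IsOneSelectionSet S := by
  obtain ⟨f, hf, hmem⟩ := (Finset.all_card_le_biUnion_card_iff_exists_injective
    fun e : S => Finset.univ.filter (· ∈ (e : Sym2 V))).1 fun T => by
      rcases T.eq_empty_or_nonempty with rfl | hT
      · simp
      · exact h T hT
  simp only [Finset.mem_filter, Finset.mem_univ, true_and] at hmem
  have hinv := hf.isPartialInv
  refine ⟨fun v => (Function.partialInv f v).map Subtype.val, fun v e he => ?_, Set.ext fun e => ?_⟩
  · obtain ⟨e, hv, rfl⟩ := Option.map_eq_some_iff.1 he
    obtain rfl := (hinv e v).1 hv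
    exact ⟨hS e.2, hmem e⟩
  · constructor
    · rintro ⟨v, hv⟩
      obtain ⟨e, -, rfl⟩ := Option.map_eq_some_iff.1 hv
      exact e.2
    · intro he
      exact ⟨f ⟨e, he⟩, Option.map_eq_some_iff.2 ⟨⟨e, he⟩, (hinv _ _).2 rfl, rfl⟩⟩

namespace RotationSystem

/-- A set of edges that carries at most one nonzero mod 2 cycle is a 1-selection set: `T` edges
on `U` vertices have an incidence matrix of rank at most `|U| - 1` and nullity at most 1. -/
theorem isOneSelectionSet_of_cycles [Fintype V] [Fintype G.edgeSet] {S : Set (Sym2 V)}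
    (hS : S ⊆ G.edgeSet)
    (h : ∀ z w : G.edgeSet → ZMod 2, (∀ e : G.edgeSet, (e : Sym2 V) ∉ S → z e = 0) →
      (∀ e : G.edgeSet, (e : Sym2 V) ∉ S → w e = 0) → (vertexMatrix G).mulVec z = 0 →
      (vertexMatrix G).mulVec w = 0 → z ≠ 0 → w ≠ 0 → z = w) :
    G.IsOneSelectionSet S := by
  refine isOneSelectionSet_of_card_le hS fun T hT => ?_
  set U := T.biUnion fun e => Finset.univ.filter (· ∈ (e : Sym2 V)) with hU
  have hmemU : ∀ (e : T) (v : V), v ∈ (e.1 : Sym2 V) → v ∈ U := fun e v hv =>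
    Finset.mem_biUnion.2 ⟨e.1, e.2, by simpa using hv⟩
  let toE : T → G.edgeSet := fun e => ⟨e.1.1, hS e.1.2⟩
  have htoE : Function.Injective toE := fun e e' he =>
    Subtype.ext (Subtype.ext (Subtype.mk.inj he))
  let B : Matrix U T (ZMod 2) := (vertexMatrix G).submatrix Subtype.val toE
  -- Each column of `B` has two entries 1, so its rows sum to zero.
  have hB : Matrix.vecMul 1 B = 0 := by
    funext e
    obtain ⟨d, hd⟩ := exists_dart_edge_eq (toE e)
    have h1 := vecMul_vertexMatrix (1 : V → ZMod 2) d
    have h2 : (⟨d.edge, d.edge_mem⟩ : G.edgeSet) = toE e := Subtype.ext hd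
    rw [h2, Pi.one_apply, Pi.one_apply, CharTwo.add_self_eq_zero] at h1
    rw [Pi.zero_apply, ← h1]
    simp only [Matrix.vecMul, dotProduct, Pi.one_apply, one_mul, B, Matrix.submatrix_apply]
    rw [Finset.sum_coe_sort U (fun v => vertexMatrix G v (toE e))]
    refine Finset.sum_subset (Finset.subset_univ _) fun v _ hv => ?_
    exact if_neg fun hv' => hv (hmemU e v hv')
  have hrank : B.rank + 1 ≤ U.card := by
    have h1 := B.transpose.mulVecLin.finrank_range_add_finrank_ker
    have h2 : Module.finrank (ZMod 2) (LinearMap.range B.transpose.mulVecLin) = B.rank :=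
      B.rank_transpose
    rw [Module.finrank_fintype_fun_eq_card, h2, Fintype.card_coe] at h1
    have h3 : 0 < Module.finrank (ZMod 2) (LinearMap.ker B.transpose.mulVecLin) := by
      rw [Module.finrank_pos_iff_exists_ne_zero]
      refine ⟨⟨1, ?_⟩, fun h0 => ?_⟩
      · rw [LinearMap.mem_ker, Matrix.mulVecLin_apply, Matrix.mulVec_transpose, hB]
      · obtain ⟨e, he⟩ := hT
        obtain ⟨d, hd⟩ := exists_dart_edge_eq (toE ⟨e, he⟩)
        have hv : d.fst ∈ U := hmemU ⟨e, he⟩ _ (by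
          change d.fst ∈ (toE ⟨e, he⟩ : Sym2 V)
          rw [← hd, Dart.mem_edge_iff]
          exact Or.inl rfl)
        exact one_ne_zero (congrFun (congrArg Subtype.val h0) ⟨_, hv⟩)
    omega
  have hker : Module.finrank (ZMod 2) (LinearMap.ker B.mulVecLin) ≤ 1 := by
    let ext0 : (T → ZMod 2) → G.edgeSet → ZMod 2 := fun z => Function.extend toE z 0
    have hext : ∀ z e, ext0 z (toE e) = z e := fun z e => htoE.extend_apply z 0 e
    have hsupp : ∀ z (e : G.edgeSet), (e : Sym2 V) ∉ S → ext0 z e = 0 := fun z e he =>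
      Function.extend_apply' _ _ _ fun ⟨t, ht⟩ => he (ht ▸ t.1.2)
    have hcyc : ∀ z, B.mulVec z = 0 → (vertexMatrix G).mulVec (ext0 z) = 0 := by
      intro z hz
      have hsum : ∀ v, (vertexMatrix G).mulVec (ext0 z) v =
          ∑ e : T, vertexMatrix G v (toE e) * z e := by
        intro v
        simp only [Matrix.mulVec, dotProduct]
        rw [← Finset.sum_subset (Finset.subset_univ (Finset.univ.map ⟨toE, htoE⟩)),
          Finset.sum_map]
        · exact Finset.sum_congr rfl fun e _ => by rw [← hext z e]; rfl
        · intro e _ he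
          have : ext0 z e = 0 := Function.extend_apply' _ _ _ fun ⟨t, ht⟩ => he (by
            rw [← ht]; exact Finset.mem_map_of_mem ⟨toE, htoE⟩ (Finset.mem_univ t))
          rw [this, mul_zero]
      funext v
      rw [hsum]
      by_cases hv : v ∈ U
      · exact congrFun hz ⟨v, hv⟩
      · refine Finset.sum_eq_zero fun e _ => ?_
        have : vertexMatrix G v (toE e) = 0 := if_neg fun hv' => hv (hmemU e v hv')
        rw [this, zero_mul]
    by_cases hz : ∃ z : LinearMap.ker B.mulVecLin, z ≠ 0
    · obtain ⟨z, hz⟩ := hz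
      have hne : ∀ y : LinearMap.ker B.mulVecLin, y ≠ 0 → ext0 y.1 ≠ 0 := fun y hy h0 =>
        hy (Subtype.ext (funext fun e => by rw [← hext y.1 e, h0]; rfl))
      refine finrank_le_one z fun w => ?_
      by_cases hw : w = 0
      · exact ⟨0, by rw [hw, zero_smul]⟩
      · refine ⟨1, ?_⟩
        rw [one_smul]
        have := h _ _ (hsupp z.1) (hsupp w.1) (hcyc _ z.2) (hcyc _ w.2) (hne z hz) (hne w hw)
        exact Subtype.ext (funext fun e => by rw [← hext z.1 e, this, hext])
    · push Not at hz
      have : Subsingleton (LinearMap.ker B.mulVecLin) := ⟨fun a b => (hz a).trans (hz b).symm⟩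
      rw [Module.finrank_zero_of_subsingleton]
      exact zero_le_one
  have h1 := B.mulVecLin.finrank_range_add_finrank_ker
  rw [Module.finrank_fintype_fun_eq_card, Fintype.card_coe] at h1
  have h2 : Module.finrank (ZMod 2) (LinearMap.range B.mulVecLin) = B.rank := rfl
  omega

variable {R : G.RotationSystem} {C : Graph R.Face (Sym2 V)}

theorem IsPlane.isOneSelectionSet (hR : R.IsPlane) (hC : C.IsFactor R.dual 2)
    (hcycles : C.cycleSubgraphs.encard ≤ 2) :
    G.IsOneSelectionSet (G.edgeSet \ C.edgeSet) := by
  have := hR.1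
  have := hR.finite_dart
  have := Fintype.ofFinite V
  have := Fintype.ofFinite G.Dart
  have := Fintype.ofFinite G.edgeSet
  have := Fintype.ofFinite R.Face
  -- A set of faces whose boundary avoids `C` is a union of components of `C`.
  have hconst : ∀ x : R.Face → ZMod 2,
      (∀ e : G.edgeSet, (e : Sym2 V) ∉ G.edgeSet \ C.edgeSet →
        Matrix.vecMul x R.faceMatrix e = 0) →
      ∀ φ ψ, Relation.ReflTransGen C.Adj φ ψ → x φ = x ψ := by
    intro x hx φ ψ h
    induction h with
    | refl => rfl
    | tail _ hadj ih =>
      obtain ⟨e, he⟩ := hadj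
      obtain ⟨d, rfl, rfl, rfl⟩ := he.mono hC.1.le
      refine ih.trans (CharTwo.add_eq_zero.1 ?_)
      rw [← vecMul_faceMatrix]
      exact hx _ fun h' => h'.2 he.edge_mem
  have hV : ∀ φ, φ ∈ C.vertexSet := fun φ => by rw [hC.1.vertexSet_eq]; exact Set.mem_univ _
  -- A set of faces that is constant has no boundary.
  have hzero : ∀ x : R.Face → ZMod 2, (∀ φ ψ, x φ = x ψ) → Matrix.vecMul x R.faceMatrix = 0 := by
    intro x hx
    funext e
    obtain ⟨d, hd⟩ := exists_dart_edge_eq e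
    have : e = ⟨d.edge, d.edge_mem⟩ := Subtype.ext hd.symm
    rw [this, vecMul_faceMatrix, hx _ (R.face d.symm), CharTwo.add_self_eq_zero, Pi.zero_apply]
  refine isOneSelectionSet_of_cycles Set.sdiff_subset fun z w hz hw hz0 hw0 hzne hwne => ?_
  obtain ⟨x, rfl⟩ := hR.exists_boundary hz0
  obtain ⟨y, rfl⟩ := hR.exists_boundary hw0
  have hx := hconst x hz
  have hy := hconst y hw
  obtain ⟨a, b, hab⟩ : ∃ a b, x a ≠ x b := by
    by_contra! hcon
    exact hzne (hzero x hcon)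
  have hnab : ¬ Relation.ReflTransGen C.Adj a b := fun h => hab (hx a b h)
  have hcover : ∀ c, Relation.ReflTransGen C.Adj a c ∨ Relation.ReflTransGen C.Adj b c := fun c =>
    Graph.exists_reflTransGen_of_encard_le_two hC.2 hcycles (hV a) (hV b) (hV c) hnab
  have hyab : y a ≠ y b := by
    intro h
    have hya : ∀ c, y a = y c := fun c => (hcover c).elim (hy a c) fun hc => h.trans (hy b c hc)
    exact hwne (hzero y fun c c' => (hya c).symm.trans (hya c'))
  -- Both `x` and `y` take different values on the two components, so `x + y` is constant.
  have hdecide : ∀ p q r s : ZMod 2, p ≠ q → r ≠ s → p + r = q + s := by decide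
  have hsum : x a + y a = x b + y b := hdecide _ _ _ _ hab hyab
  have hxy : ∀ c, x a + y a = x c + y c := fun c =>
    (hcover c).elim (fun hc => by rw [hx a c hc, hy a c hc])
      fun hc => by rw [hsum, hx b c hc, hy b c hc]
  have h0 := hzero (x + y) fun c c' => (hxy c).symm.trans (hxy c')
  rw [Matrix.add_vecMul] at h0
  funext e
  exact CharTwo.add_eq_zero.1 (congrFun h0 e)

end RotationSystem

end SimpleGraph

namespace SimpleGraph.RotationSystem

variable {V : Type*} {G : SimpleGraph V} {R : G.RotationSystem} {S : Set (Sym2 V)}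

/-! ### The embedding inherited by the quadrangulation -/

/-- A dart of `G - S`, as a dart of `G`. -/
abbrev inclDart (d : (G.deleteEdges S).Dart) : G.Dart :=
  (Hom.ofLE (deleteEdges_le S)).mapDart d

theorem inclDart_injective : Function.Injective (inclDart (G := G) (S := S)) := fun d d' h => by
  refine Dart.ext _ _ (Prod.ext ?_ ?_)
  · exact congrArg (fun d : G.Dart => d.fst) h
  · exact congrArg (fun d : G.Dart => d.snd) h

theorem edge_inclDart_notMem (d : (G.deleteEdges S).Dart) : (inclDart d).edge ∉ S :=
  (deleteEdges_adj.1 d.adj).2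

/-- A dart of `G` whose edge is not in `S`, as a dart of `G - S`. -/
def liftDart (d : G.Dart) (hd : d.edge ∉ S) : (G.deleteEdges S).Dart :=
  ⟨d.toProd, deleteEdges_adj.2 ⟨d.adj, hd⟩⟩

@[simp]
theorem inclDart_liftDart (d : G.Dart) (hd : d.edge ∉ S) : inclDart (liftDart d hd) = d := rfl

namespace IsDualMatching

variable (hS : R.IsDualMatching S)
include hS

/-- Two consecutive edges around a vertex lie on a common face, so they are not both in `S`. -/
theorem next_next_notMem {d : G.Dart} (hd : (R.next d).edge ∈ S) :
    (R.next (R.next d)).edge ∉ S := by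
  rw [R.next_eq_faceStep_symm (R.next d)]
  exact hS.next_notMem _ (by rwa [Dart.edge_symm])

open scoped Classical in
/-- The first dart outside `S` after a given one. At most one dart has to be skipped. -/
noncomputable def nextDart (d : (G.deleteEdges S).Dart) : (G.deleteEdges S).Dart :=
  if h : (R.next (inclDart d)).edge ∈ S then liftDart _ (hS.next_next_notMem h)
  else liftDart _ h

theorem inclDart_nextDart_of_mem {d : (G.deleteEdges S).Dart}
    (h : (R.next (inclDart d)).edge ∈ S) :
    inclDart (hS.nextDart d) = R.next (R.next (inclDart d)) := by
  rw [nextDart, dif_pos h, inclDart_liftDart]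

theorem inclDart_nextDart_of_notMem {d : (G.deleteEdges S).Dart}
    (h : (R.next (inclDart d)).edge ∉ S) :
    inclDart (hS.nextDart d) = R.next (inclDart d) := by
  rw [nextDart, dif_neg h, inclDart_liftDart]

theorem nextDart_fst (d : (G.deleteEdges S).Dart) : (hS.nextDart d).fst = d.fst := by
  change (inclDart (hS.nextDart d)).fst = (inclDart d).fst
  by_cases h : (R.next (inclDart d)).edge ∈ S
  · rw [hS.inclDart_nextDart_of_mem h, R.next_fst, R.next_fst]
  · rw [hS.inclDart_nextDart_of_notMem h, R.next_fst]

theorem nextDart_injective : Function.Injective hS.nextDart := by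
  intro a b hab
  replace hab := congrArg inclDart hab
  apply inclDart_injective
  by_cases ha : (R.next (inclDart a)).edge ∈ S <;> by_cases hb : (R.next (inclDart b)).edge ∈ S
  · rw [hS.inclDart_nextDart_of_mem ha, hS.inclDart_nextDart_of_mem hb] at hab
    exact R.next.injective (R.next.injective hab)
  · rw [hS.inclDart_nextDart_of_mem ha, hS.inclDart_nextDart_of_notMem hb] at hab
    rw [R.next.injective hab] at ha
    exact absurd ha (edge_inclDart_notMem b)
  · rw [hS.inclDart_nextDart_of_notMem ha, hS.inclDart_nextDart_of_mem hb] at hab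
    rw [← R.next.injective hab] at hb
    exact absurd hb (edge_inclDart_notMem a)
  · rw [hS.inclDart_nextDart_of_notMem ha, hS.inclDart_nextDart_of_notMem hb] at hab
    exact R.next.injective hab

variable [Finite G.Dart]

omit hS in
theorem finite_dart_deleteEdges : Finite (G.deleteEdges S).Dart :=
  Finite.of_injective _ inclDart_injective

/-- The rotation system that `R` induces on `G - S`. -/
noncomputable def rotation : (G.deleteEdges S).RotationSystem where
  next :=
    have := finite_dart_deleteEdges (G := G) (S := S)
    Equiv.ofBijective hS.nextDart (Finite.injective_iff_bijective.1 hS.nextDart_injective)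
  next_fst := hS.nextDart_fst
  sameCycle_of_fst_eq := by
    intro d d' h
    obtain ⟨n, hn⟩ := (R.sameCycle_of_fst_eq (inclDart d) (inclDart d') h).exists_nat_pow_eq
    rw [← Equiv.Perm.iterate_eq_pow] at hn
    clear h
    induction n using Nat.strong_induction_on generalizing d with
    | _ n ih =>
      rw [← Equiv.Perm.sameCycle_apply_left]
      match n with
      | 0 =>
        rw [Equiv.Perm.sameCycle_apply_left, inclDart_injective hn]
      | n + 1 =>
        rw [Function.iterate_succ_apply] at hn
        by_cases hd : (R.next (inclDart d)).edge ∈ S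
        · match n with
          | 0 =>
            rw [Function.iterate_zero_apply] at hn
            rw [hn] at hd
            exact absurd hd (edge_inclDart_notMem d')
          | n + 1 =>
            rw [Function.iterate_succ_apply] at hn
            refine ih n (by omega) _ ?_
            rw [← hn]
            exact congrArg _ (hS.inclDart_nextDart_of_mem hd)
        · refine ih n (by omega) _ ?_
          rw [← hn]
          exact congrArg _ (hS.inclDart_nextDart_of_notMem hd)

theorem rotation_next (d : (G.deleteEdges S).Dart) : hS.rotation.next d = hS.nextDart d := rfl

theorem induces_rotation : R.Induces (deleteEdges_le S) hS.rotation := by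
  intro d
  rw [rotation_next]
  by_cases h : (R.next (inclDart d)).edge ∈ S
  · refine ⟨2, by omega, (hS.inclDart_nextDart_of_mem h).symm, fun j h0 h2 => ?_⟩
    obtain rfl : j = 1 := by omega
    rw [edgeSet_deleteEdges]
    exact fun h' => h'.2 h
  · exact ⟨1, by omega, (hS.inclDart_nextDart_of_notMem h).symm, fun j h0 h2 => by omega⟩

theorem inclDart_faceStep_of_mem {d : (G.deleteEdges S).Dart}
    (h : (R.faceStep (inclDart d)).edge ∈ S) :
    inclDart (hS.rotation.faceStep d) = R.faceStep (R.faceStep (inclDart d)).symm := by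
  rw [← R.next_eq_faceStep_symm]
  exact hS.inclDart_nextDart_of_mem (d := d.symm) h

theorem inclDart_faceStep_of_notMem {d : (G.deleteEdges S).Dart}
    (h : (R.faceStep (inclDart d)).edge ∉ S) :
    inclDart (hS.rotation.faceStep d) = R.faceStep (inclDart d) :=
  hS.inclDart_nextDart_of_notMem (d := d.symm) h

/-- The facial walk through a dart `d` followed by a dart of `S` crosses to the other triangle on
that edge, and back. -/
theorem faceStep_iterate_of_mem (h : R.IsTriangular) {d : (G.deleteEdges S).Dart}
    (hd : (R.faceStep (inclDart d)).edge ∈ S) :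
    hS.rotation.faceStep^[4] d = d ∧ hS.rotation.faceStep^[2] d ≠ d := by
  set t := (R.faceStep (inclDart d)).symm with ht
  have htS : t.edge ∈ S := by rwa [ht, Dart.edge_symm]
  have e1 : inclDart (hS.rotation.faceStep d) = R.faceStep t := hS.inclDart_faceStep_of_mem hd
  have e2 : inclDart (hS.rotation.faceStep^[2] d) = R.faceStep (R.faceStep t) := by
    have := hS.inclDart_faceStep_of_notMem (d := hS.rotation.faceStep d)
      (by rw [e1]; exact hS.prev_notMem t htS)
    rwa [e1] at this
  have e3 : inclDart (hS.rotation.faceStep^[3] d) = R.faceStep (R.faceStep (inclDart d)) := by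
    have := hS.inclDart_faceStep_of_mem (d := hS.rotation.faceStep^[2] d)
      (by rw [e2, h t]; exact htS)
    rw [e2, h t, ht, Dart.symm_symm] at this
    exact this
  have e4 : inclDart (hS.rotation.faceStep^[4] d) = inclDart d := by
    have := hS.inclDart_faceStep_of_notMem (d := hS.rotation.faceStep^[3] d)
      (by rw [e3, h]; exact edge_inclDart_notMem d)
    rw [e3, h] at this
    exact this
  refine ⟨inclDart_injective e4, fun h2 => ?_⟩
  rw [h2] at e2
  have h3 := congrArg R.face e2
  rw [face_faceStep, face_faceStep, ht] at h3
  exact h.face_symm_ne (R.faceStep (inclDart d)) (h3.symm.trans (R.face_faceStep _).symm)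

theorem faceStep_iterate (h : R.IsTriangular) (d : (G.deleteEdges S).Dart) :
    hS.rotation.faceStep^[4] d = d ∧ hS.rotation.faceStep^[2] d ≠ d := by
  by_cases hd : (R.faceStep (inclDart d)).edge ∈ S
  · exact hS.faceStep_iterate_of_mem h hd
  · have e1 := hS.inclDart_faceStep_of_notMem hd
    have := hS.faceStep_iterate_of_mem h (d := hS.rotation.faceStep d) (by
      rw [e1]
      exact hS.mem_of_notMem _ (edge_inclDart_notMem d) hd)
    rw [← Function.iterate_succ_apply, ← Function.iterate_succ_apply,
      Function.iterate_succ_apply', Function.iterate_succ_apply'] at this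
    exact ⟨hS.rotation.faceStep.injective this.1, fun h2 => this.2 (congrArg _ h2)⟩

theorem faceLength_rotation (h : R.IsTriangular) (φ : hS.rotation.Face) :
    hS.rotation.faceLength φ = 4 := by
  have := finite_dart_deleteEdges (G := G) (S := S)
  obtain ⟨d, rfl⟩ := hS.rotation.exists_face_eq φ
  rw [faceLength_face]
  have h4 := hS.faceStep_iterate h d
  have hdvd : Function.minimalPeriod hS.rotation.faceStep d ∣ 4 :=
    Function.IsPeriodicPt.minimalPeriod_dvd h4.1
  have hndvd : ¬ Function.minimalPeriod hS.rotation.faceStep d ∣ 2 := fun h2 =>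
    h4.2 ((Function.isPeriodicPt_minimalPeriod _ d).trans_dvd h2)
  have hle := Nat.le_of_dvd (by omega) hdvd
  generalize Function.minimalPeriod hS.rotation.faceStep d = m at *
  interval_cases m <;> omega

omit [Finite G.Dart] in
/-- The ends of an edge of `S` are joined by the other two sides of a triangle. -/
theorem connected_deleteEdges (hG : G.Connected) (h : R.IsTriangular) :
    (G.deleteEdges S).Connected := by
  have hadj : ∀ d : G.Dart, d.edge ∉ S → (G.deleteEdges S).Reachable d.fst d.snd :=
    fun d hd => Adj.reachable (deleteEdges_adj.2 ⟨d.adj, hd⟩)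
  have hreach : ∀ u v, G.Adj u v → (G.deleteEdges S).Reachable u v := by
    intro u v huv
    let d : G.Dart := ⟨(u, v), huv⟩
    by_cases hd : d.edge ∈ S
    · have h1 := hadj _ (hS.next_notMem d hd)
      have h2 := hadj _ (hS.prev_notMem d hd)
      rw [faceStep_fst] at h1
      rw [faceStep_fst, h.snd_faceStep_faceStep] at h2
      exact (h1.trans h2).symm
    · exact hadj d hd
  have := hG.nonempty
  refine ⟨fun u v => ?_⟩
  obtain ⟨p⟩ := hG.preconnected u v
  induction p with
  | nil => exact Reachable.refl _
  | cons huv _ ih => exact (hreach _ _ huv).trans ih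

end IsDualMatching

/-! ### Counting darts, edges and faces -/

theorem _root_.Nat.card_eq_mul_of_card_fiber {α β : Type*} [Finite α] [Finite β] (f : α → β) (k : ℕ)
    (h : ∀ b, Nat.card {a // f a = b} = k) : Nat.card α = k * Nat.card β := by
  have := Fintype.ofFinite β
  rw [← Nat.card_congr (Equiv.sigmaFiberEquiv f), Nat.card_sigma, Finset.sum_congr rfl fun b _ => h b,
    Finset.sum_const, Finset.card_univ, Nat.card_eq_fintype_card, smul_eq_mul, mul_comm]

theorem card_dart_eq_mul_card_face [Finite G.Dart] {k : ℕ} (h : ∀ φ, R.faceLength φ = k) :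
    Nat.card G.Dart = k * Nat.card R.Face :=
  Nat.card_eq_mul_of_card_fiber R.face k h

theorem _root_.SimpleGraph.card_dart_eq_two_mul_card_edgeSet [Finite V] (G : SimpleGraph V) :
    Nat.card G.Dart = 2 * Nat.card G.edgeSet := by
  classical
  have := Fintype.ofFinite V
  rw [Nat.card_eq_fintype_card, Nat.card_eq_fintype_card, dart_card_eq_twice_card_edges,
    card_edgeSet]

theorem IsDualMatching.card_dart_deleteEdges [Finite G.Dart] (hS : R.IsDualMatching S)
    (h : R.IsTriangular) : Nat.card (G.deleteEdges S).Dart = 2 * Nat.card R.Face := by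
  have := IsDualMatching.finite_dart_deleteEdges (G := G) (S := S)
  refine Nat.card_eq_mul_of_card_fiber (fun d => R.face (inclDart d)) 2 fun φ => ?_
  rw [← hS.ncard_notMem h φ]
  exact Nat.card_congr
    { toFun := fun d => ⟨inclDart d.1, d.2, edge_inclDart_notMem d.1⟩
      invFun := fun d => ⟨liftDart d.1 d.2.2, d.2.1⟩
      left_inv := fun _ => rfl
      right_inv := fun _ => rfl }

theorem IsDualMatching.isPlaneQuadrangulation [Finite G.Dart] (hS : R.IsDualMatching S)
    (hR : R.IsPlaneTriangulation) : hS.rotation.IsPlaneQuadrangulation := by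
  have := hR.1.1
  have := IsDualMatching.finite_dart_deleteEdges (G := G) (S := S)
  have h := hR.isTriangular
  have hlen := hS.faceLength_rotation h
  refine ⟨⟨hR.1.1, hS.connected_deleteEdges hR.1.2.1 h, ?_⟩, hlen⟩
  have h1 := card_dart_eq_mul_card_face hR.2
  have h2 := card_dart_eq_mul_card_face hlen
  have h3 := G.card_dart_eq_two_mul_card_edgeSet
  have h4 := (G.deleteEdges S).card_dart_eq_two_mul_card_edgeSet
  have h5 := hS.card_dart_deleteEdges h
  have h6 := hR.1.2.2
  omega

end SimpleGraph.RotationSystem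

/-! ### The robust chromatic number -/

namespace SimpleGraph

variable {V : Type*} {G : SimpleGraph V}

/-- A graph with more edges than vertices keeps an edge after the removal of a 1-selection set. -/
theorem two_le_robustChromaticNumber [Finite V] (h : Nat.card V < Nat.card G.edgeSet) :
    2 ≤ G.robustChromaticNumber := by
  refine le_iInf fun f => ?_
  obtain ⟨e, heG, he⟩ : ∃ e ∈ G.edgeSet, e ∉ selectedEdges f.1 := by
    by_contra! hcon
    have h1 : some '' G.edgeSet ⊆ Set.range f.1 := by
      rintro _ ⟨e, he, rfl⟩
      exact hcon e he
    have h2 := Set.ncard_le_ncard h1 (Set.toFinite _)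
    rw [Set.ncard_image_of_injective _ (Option.some_injective _), ← Set.image_univ] at h2
    have h3 := Set.ncard_image_le (f := f.1) (Set.toFinite Set.univ)
    rw [Set.ncard_univ] at h3
    exact absurd h (not_lt.2 (h2.trans h3))
  induction e with
  | _ u v => exact two_le_chromaticNumber_of_adj (deleteEdges_adj.2 ⟨heG, he⟩)

theorem IsOneSelectionSet.robustChromaticNumber_le {S : Set (Sym2 V)} (hS : G.IsOneSelectionSet S)
    {n : ℕ} (h : (G.deleteEdges S).Colorable n) : G.robustChromaticNumber ≤ n := by
  obtain ⟨f, hf, rfl⟩ := hS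
  exact iInf_le_of_le (ι := {f : V → Option (Sym2 V) // G.IsOneSelection f}) ⟨f, hf⟩
    h.chromaticNumber_le

theorem RotationSystem.IsPlaneTriangulation.card_lt_card_edgeSet {R : G.RotationSystem}
    (hR : R.IsPlaneTriangulation) (h : 4 ≤ Nat.card V) : Nat.card V < Nat.card G.edgeSet := by
  have := hR.1.1
  have := hR.1.finite_dart
  have h1 := card_dart_eq_mul_card_face hR.2
  have h2 := G.card_dart_eq_two_mul_card_edgeSet
  have h3 := hR.1.2.2
  omega

end SimpleGraph

/-- Let `G` be a plane triangulation and `C` a 2-factor of its dual with at most two cycles, and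
let `S` be the set of edges of `G` whose dual edges are not in `C`. -/
theorem proposition3p4 {V : Type*} (G : SimpleGraph V) (R : G.RotationSystem)
    (hR : R.IsPlaneTriangulation) (C : Graph R.Face (Sym2 V))
    (hC : C.IsFactor R.dual 2) (hcycles : C.cycleSubgraphs.encard ≤ 2) :
    (4 ≤ Nat.card V → G.robustChromaticNumber = 2) ∧
    (R.dual.deleteEdges C.edgeSet).IsFactor R.dual 1 ∧
    G.IsOneSelectionSet (G.edgeSet \ C.edgeSet) ∧
    (∃ R' : (G.deleteEdges (G.edgeSet \ C.edgeSet)).RotationSystem,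
      R.Induces (SimpleGraph.deleteEdges_le _) R' ∧ R'.IsPlaneQuadrangulation) ∧
    (G.deleteEdges (G.edgeSet \ C.edgeSet)).IsBipartite := by
  have := hR.1.1
  have := hR.1.finite_dart
  have hS := hR.isTriangular.isDualMatching hC
  have hsel := hR.1.isOneSelectionSet hC hcycles
  have hbip := hS.isBipartite hR
  exact ⟨fun h4 => le_antisymm (hsel.robustChromaticNumber_le hbip)
      (SimpleGraph.two_le_robustChromaticNumber (hR.card_lt_card_edgeSet h4)),
    hR.isTriangular.isFactor_one hC, hsel,
    ⟨hS.rotation, hS.induces_rotation, hS.isPlaneQuadrangulation hR⟩, hbip⟩
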